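/- Let $X$ be a $T_1$-space and let $\tau$ be an infinite cardinal. The following are equivalent. (a) $X$ is countably paracompact (every countable open cover of $X$ has a locally finite open refinement) and $\tau$-collectionwise normal, that is, $X$ is a $T_1$-space and for every discrete collection $\mathscr{D}$ of closed subsets of $X$ with $|\mathscr{D}|\le\tau$ there is a discrete family $\{U_D : D\in\mathscr{D}\}$ of open subsets of $X$, indexed by $\mathscr{D}$, such that $D\subset U_D$ for every $D\in\mathscr{D}$. (A family of subsets of $X$ is discrete if every point of $X$ has a neighbourhood that meets at most one member of the family.) (b) For every real Banach space $E$ whose topological weight $w(E)$ (the least cardinality of a base) is at most $\tau$, every map $\varphi$ that assigns to each $x\in X$ a convex set $\varphi(x)\subset E$ which is either nonempty and compact or equal to $E$, and which is lower semi-continuous in the sense that $\{x\in X:\varphi(x)\cap U\neq\emptyset\}$ is open in $X$ for every open $U\subset E$, every lower semi-continuous function $\eta:X\to(0,+\infty)$, and every continuous map $g:X\to E$ with $d(g(x),\varphi(x))<\eta(x)$ for all $x\in X$, there is a continuous map $f:X\to E$ such that $f(x)\in\varphi(x)$ and $d(f(x),g(x))<\eta(x)$ for all $x\in X$. Here $d$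 is the metric given by the norm of $E$, and $d(y,S)=\inf_{s\in S}d(y,s)$. -/

import Mathlib

open scoped Topology Cardinal

universe u

/-- An indexed family of subsets of `X` is discrete if every point of `X` has a neighbourhood that
meets at most one member of the family (members are counted by their index). -/
def IsDiscreteFamily {X : Type*} [TopologicalSpace X] {ι : Type*} (F : ι → Set X) : Prop :=
  ∀ x : X, ∃ N ∈ 𝓝 x, {i : ι | (F i ∩ N).Nonempty}.Subsingleton

/-- `X` is `τ`-collectionwise normal: it is a `T₁`-space, and every discrete collection of at most
`τ` closed sets can be expanded to a discrete family of open sets. -/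
structure IsCollectionwiseNormal (X : Type u) [TopologicalSpace X] (τ : Cardinal.{u}) : Prop where
  t1 : T1Space X
  exists_expansion : ∀ 𝒟 : Set (Set X), (∀ D ∈ 𝒟, IsClosed D) →
    IsDiscreteFamily (fun D : 𝒟 => (D : Set X)) → #𝒟 ≤ τ →
    ∃ U : 𝒟 → Set X, (∀ D, IsOpen (U D)) ∧ IsDiscreteFamily U ∧ ∀ D : 𝒟, (D : Set X) ⊆ U D

/-- `X` is countably paracompact: every countable open cover has a locally finite open
refinement. -/
def IsCountablyParacompact (X : Type*) [TopologicalSpace X] : Prop :=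
  ∀ 𝒰 : Set (Set X), 𝒰.Countable → (∀ U ∈ 𝒰, IsOpen U) → ⋃₀ 𝒰 = Set.univ →
    ∃ 𝒱 : Set (Set X), (∀ V ∈ 𝒱, IsOpen V) ∧ ⋃₀ 𝒱 = Set.univ ∧
      LocallyFinite (fun V : 𝒱 => (V : Set X)) ∧ ∀ V ∈ 𝒱, ∃ U ∈ 𝒰, V ⊆ U

/-- The weight of a topological space: the least cardinality of a base. -/
noncomputable def topologicalWeight (E : Type u) [TopologicalSpace E] : Cardinal.{u} :=
  sInf {κ | ∃ B : Set (Set E), TopologicalSpace.IsTopologicalBasis B ∧ #B = κ}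

/-- The nonempty compact (closed) subsets of `E`, together with `E` itself. -/
def compactsOrUniv (E : Type*) [TopologicalSpace E] : Set (Set E) :=
  {S | S.Nonempty ∧ IsClosed S ∧ IsCompact S} ∪ {Set.univ}

/-- `f` is a selection for the set-valued map `φ`. -/
def IsSelection {X E : Type*} (f : X → E) (φ : X → Set E) : Prop :=
  ∀ x, f x ∈ φ x

/-- `g` is an `η`-selection for the (nonempty-valued) map `φ`: the distance from `g x` to the set
`φ x` is less than `η x` for every `x`. -/
def IsApproxSelection {X E : Type*} [PseudoMetricSpace E] (g : X → E) (η : X → ℝ)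
    (φ : X → Set E) : Prop :=
  ∀ x, Metric.infDist (g x) (φ x) < η x

/-!
From covering properties to selections: countable paracompactness inserts a continuous `α` between
`x ↦ d(g x, φ x)` and `η`, and rescaling by `α` reduces to `g = 0` and `α = 1`. A selection is then
the uniform limit of maps into the unit ball that come closer and closer to `φ`, each obtained by
averaging over a locally finite open refinement of the cover `{x | φ x ∩ U i ≠ ∅}`, for a fine
locally finite cover `U` of `E`. This cover is point-finite where `φ x` is compact. Where `φ x = E`
the previous approximation `f` already takes values in `φ`, and the sets `f ⁻¹' U i` serve instead.

Conversely, a discrete closed family `𝒟` is separated by a continuous map into `ℓ¹(𝒟)` which sends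
each `D ∈ 𝒟` to its basis vector, that is, by a selection of a map with singleton values on `⋃ 𝒟`
and the value `E` elsewhere. For upper semicontinuous `a`, a selection of
`x ↦ [arctan (a x), π / 2]` which keeps distance less than `π / 2` from `0` never attains `π / 2`,
so its tangent is a continuous function above `a`. A space in which such functions exist is
countably paracompact: given an open cover `U n`, take `a x` to be the first `n` with `x ∈ U n`.
-/

section LocallyFinite

variable {X ι κ : Type*} [TopologicalSpace X]

theorem locallyFinite_union {V W : ι → Set X} (hV : LocallyFinite V) (hW : LocallyFinite W) :
    LocallyFinite fun i => V i ∪ W i := by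
  intro x
  obtain ⟨N, hN, hNf⟩ := hV x
  obtain ⟨M, hM, hMf⟩ := hW x
  refine ⟨N ∩ M, Filter.inter_mem hN hM, (hNf.union hMf).subset ?_⟩
  rintro i ⟨y, hy | hy, hyN, hyM⟩
  exacts [Or.inl ⟨y, hy, hyN⟩, Or.inr ⟨y, hy, hyM⟩]

theorem locallyFinite_inter_prod {H : κ → Set X} {V : κ → ι → Set X} (hH : LocallyFinite H)
    (hV : ∀ k, LocallyFinite (V k)) : LocallyFinite fun p : κ × ι => H p.1 ∩ V p.1 p.2 := by
  intro x
  obtain ⟨N, hN, hNf⟩ := hH x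
  choose M hM hMf using fun k => hV k x
  refine ⟨N ∩ ⋂ k ∈ {k | (H k ∩ N).Nonempty}, M k,
    Filter.inter_mem hN ((Filter.biInter_mem hNf).2 fun k _ => hM k),
    (hNf.biUnion fun k _ => (hMf k).image (Prod.mk k)).subset ?_⟩
  rintro ⟨k, i⟩ ⟨y, ⟨hyH, hyV⟩, hyN, hyM⟩
  have hk : k ∈ {k | (H k ∩ N).Nonempty} := ⟨y, hyH, hyN⟩
  exact Set.mem_biUnion hk ⟨i, ⟨y, hyV, Set.mem_iInter₂.1 hyM k hk⟩, rfl⟩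

theorem locallyFinite_iUnion_of_finite {U : κ → Set X} (hU : LocallyFinite U) {t : κ → Set ι}
    (ht : ∀ k, (t k).Finite) : LocallyFinite fun i => ⋃ (k) (_ : i ∈ t k), U k := by
  intro x
  obtain ⟨N, hN, hNf⟩ := hU x
  refine ⟨N, hN, (hNf.biUnion fun k _ => ht k).subset ?_⟩
  rintro i ⟨y, hy, hyN⟩
  obtain ⟨k, hik, hyk⟩ := Set.mem_iUnion₂.1 hy
  exact Set.mem_biUnion (show k ∈ {k | (U k ∩ N).Nonempty} from ⟨y, hyk, hyN⟩) hik

end LocallyFinite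

namespace IsDiscreteFamily

variable {X Y ι : Type*} [TopologicalSpace X] [TopologicalSpace Y] {F : ι → Set X}

theorem locallyFinite (hF : IsDiscreteFamily F) : LocallyFinite F := fun x =>
  (hF x).imp fun _ hN => ⟨hN.1, hN.2.finite⟩

theorem eq_of_mem (hF : IsDiscreteFamily F) {x : X} {i j : ι} (hi : x ∈ F i) (hj : x ∈ F j) :
    i = j := by
  obtain ⟨N, hN, hs⟩ := hF x
  exact hs ⟨x, hi, mem_of_mem_nhds hN⟩ ⟨x, hj, mem_of_mem_nhds hN⟩

theorem preimage (hF : IsDiscreteFamily F) {f : Y → X} (hf : Continuous f) :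
    IsDiscreteFamily fun i => f ⁻¹' F i := by
  intro y
  obtain ⟨N, hN, hs⟩ := hF (f y)
  refine ⟨f ⁻¹' N, hf.continuousAt hN, hs.anti ?_⟩
  rintro i ⟨z, hz, hzN⟩
  exact ⟨f z, hz, hzN⟩

theorem of_locallyFinite (hl : LocallyFinite F) (hc : ∀ i, IsClosed (F i))
    (hd : Pairwise (Function.onFun Disjoint F)) : IsDiscreteFamily F := by
  refine fun x => ⟨_, hl.iInter_compl_mem_nhds hc x, ?_⟩
  have hx : ∀ i, (F i ∩ ⋂ (j) (_ : x ∉ F j), (F j)ᶜ).Nonempty → x ∈ F i := by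
    rintro i ⟨y, hy, hy'⟩
    by_contra h
    exact Set.mem_iInter₂.1 hy' i h hy
  intro i hi j hj
  by_contra hij
  exact (hd hij).notMem_of_mem_left (hx i hi) (hx j hj)

end IsDiscreteFamily

theorem isDiscreteFamily_ball {E ι : Type*} [PseudoMetricSpace E] {e : ι → E} {r : ℝ} (hr : 0 < r)
    (he : Pairwise fun i j => 4 * r ≤ dist (e i) (e j)) :
    IsDiscreteFamily fun i => Metric.ball (e i) r := by
  refine fun x => ⟨Metric.ball x r, Metric.ball_mem_nhds x hr, ?_⟩
  have hx : ∀ i, (Metric.ball (e i) r ∩ Metric.ball x r).Nonempty → dist (e i) x < 2 * r := by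
    rintro i ⟨y, hy, hyx⟩
    rw [two_mul]
    exact (dist_triangle _ y _).trans_lt (add_lt_add (Metric.mem_ball'.1 hy) hyx)
  intro i hi j hj
  by_contra hij
  linarith [he hij, dist_triangle_right (e i) (e j) x, hx i hi, hx j hj]

namespace IsCountablyParacompact

variable {X ι κ : Type*} [TopologicalSpace X] [Countable κ]

theorem exists_precise_refinement (hX : IsCountablyParacompact X) {U : κ → Set X}
    (hUo : ∀ k, IsOpen (U k)) (hU : ⋃ k, U k = Set.univ) :
    ∃ V : κ → Set X, (∀ k, IsOpen (V k)) ∧ LocallyFinite V ∧ ⋃ k, V k = Set.univ ∧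
      ∀ k, V k ⊆ U k := by
  obtain ⟨𝒱, hVo, hVc, hVl, hVU⟩ := hX (Set.range U) (Set.countable_range U)
    (Set.forall_mem_range.2 hUo) (by rwa [Set.sUnion_range])
  have hr : ∀ V : 𝒱, ∃ k, (V : Set X) ⊆ U k := fun V => by
    simpa only [Set.exists_range_iff] using hVU V V.2
  choose r hr using hr
  refine ⟨fun k => ⋃ (V : 𝒱) (_ : k ∈ ({r V} : Set κ)), V,
    fun k => isOpen_iUnion fun V => isOpen_iUnion fun _ => hVo V V.2,
    locallyFinite_iUnion_of_finite hVl fun V => Set.finite_singleton (r V),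
    Set.eq_univ_of_forall fun x => ?_, fun k => Set.iUnion₂_subset ?_⟩
  · obtain ⟨V, hV, hx⟩ := Set.mem_sUnion.1 (hVc ▸ Set.mem_univ x)
    exact Set.mem_iUnion.2 ⟨r ⟨V, hV⟩, Set.mem_iUnion₂.2 ⟨⟨V, hV⟩, rfl, hx⟩⟩
  · rintro V rfl
    exact hr V

theorem exists_locallyFinite_merge (hX : IsCountablyParacompact X) {V : κ → ι → Set X}
    (hVo : ∀ k i, IsOpen (V k i)) (hVl : ∀ k, LocallyFinite (V k))
    (hV : ⋃ k, ⋃ i, V k i = Set.univ) :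
    ∃ W : ι → Set X, (∀ i, IsOpen (W i)) ∧ LocallyFinite W ∧ ⋃ i, W i = Set.univ ∧
      ∀ i, W i ⊆ ⋃ k, V k i := by
  obtain ⟨H, hHo, hHl, hHc, hHV⟩ :=
    hX.exists_precise_refinement (fun k => isOpen_iUnion (hVo k)) hV
  refine ⟨fun i => ⋃ (p : κ × ι) (_ : i ∈ ({p.2} : Set ι)), H p.1 ∩ V p.1 p.2,
    fun i => isOpen_iUnion fun p => isOpen_iUnion fun _ => (hHo p.1).inter (hVo p.1 p.2),
    locallyFinite_iUnion_of_finite (locallyFinite_inter_prod hHl hVl)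
      fun p => Set.finite_singleton p.2,
    Set.eq_univ_of_forall fun x => ?_, fun i => Set.iUnion₂_subset ?_⟩
  · obtain ⟨k, hk⟩ := Set.mem_iUnion.1 (hHc ▸ Set.mem_univ x)
    obtain ⟨i, hi⟩ := Set.mem_iUnion.1 (hHV k hk)
    exact Set.mem_iUnion.2 ⟨i, Set.mem_iUnion₂.2 ⟨(k, i), rfl, hk, hi⟩⟩
  · rintro ⟨k, _⟩ rfl
    exact Set.inter_subset_right.trans (Set.subset_iUnion (V · _) k)

end IsCountablyParacompact

theorem isClosed_setOf_mem_subset {X ι : Type*} [TopologicalSpace X] {W : ι → Set X}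
    (hWo : ∀ i, IsOpen (W i)) (S : Set ι) : IsClosed {x | {i | x ∈ W i} ⊆ S} := by
  have h : {x | {i | x ∈ W i} ⊆ S} = ⋂ i ∈ Sᶜ, (W i)ᶜ := by
    ext x
    simp only [Set.mem_iInter, Set.mem_compl_iff]
    exact forall_congr' fun i => not_imp_not.symm
  exact h ▸ isClosed_biInter fun i _ => (hWo i).isClosed_compl

theorem isDiscreteFamily_setOf_mem_subset {X ι : Type*} [TopologicalSpace X] {A : Set X}
    (hA : IsClosed A) {W : ι → Set X} (hWo : ∀ i, IsOpen (W i)) {n : ℕ}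
    (hn : ∀ x ∈ A, n ≤ {i | x ∈ W i}.encard) :
    IsDiscreteFamily fun S : {S : Finset ι // S.card = n} => A ∩ {x | {i | x ∈ W i} ⊆ S.1} := by
  intro x
  by_cases hx : x ∈ A
  · obtain ⟨T, hTx, hTn⟩ := Set.exists_subset_encard_eq (hn x hx)
    have hTf : T.Finite := Set.finite_of_encard_eq_coe hTn
    refine ⟨⋂ i ∈ T, W i, (Filter.biInter_mem hTf).2 fun i hi => (hWo i).mem_nhds (hTx hi), ?_⟩
    have hST : ∀ S : {S : Finset ι // S.card = n},
        (A ∩ {x | {i | x ∈ W i} ⊆ S.1} ∩ ⋂ i ∈ T, W i).Nonempty → T = S.1 := by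
      rintro S ⟨y, ⟨-, hyS⟩, hyT⟩
      refine hTf.eq_of_subset_of_encard_le
        (fun i hi => hyS (Set.mem_iInter₂.1 hyT i hi)) ?_
      rw [hTn, Set.encard_coe_eq_coe_finsetCard, S.2]
    intro S hS S' hS'
    exact Subtype.ext (Finset.coe_injective ((hST S hS).symm.trans (hST S' hS')))
  · refine ⟨Aᶜ, hA.isOpen_compl.mem_nhds hx, ?_⟩
    rintro S ⟨y, hy, hyA⟩
    exact absurd hy.1 hyA

namespace IsCollectionwiseNormal

variable {X ι : Type u} [TopologicalSpace X] {τ : Cardinal.{u}}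

theorem exists_indexed_expansion (hX : IsCollectionwiseNormal X τ) (hι : #ι ≤ τ)
    {D : ι → Set X} (hDc : ∀ i, IsClosed (D i)) (hDd : IsDiscreteFamily D) :
    ∃ U : ι → Set X, (∀ i, IsOpen (U i)) ∧ IsDiscreteFamily U ∧ ∀ i, D i ⊆ U i := by
  have hRd : IsDiscreteFamily fun C : Set.range D => (C : Set X) := by
    intro x
    obtain ⟨N, hN, hs⟩ := hDd x
    refine ⟨N, hN, ?_⟩
    rintro ⟨_, i, rfl⟩ hi ⟨_, j, rfl⟩ hj
    rw [hs hi hj]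
  obtain ⟨U, hUo, hUd, hDU⟩ := hX.exists_expansion (Set.range D) (Set.forall_mem_range.2 hDc) hRd
    (Cardinal.mk_range_le.trans hι)
  -- `D` may repeat the empty set, whose expansion must then not be repeated.
  refine ⟨fun i => U ⟨D i, i, rfl⟩ ∩ {_x | (D i).Nonempty},
    fun i => (hUo _).inter isOpen_const, fun x => ?_, fun i x hx => ⟨hDU ⟨D i, i, rfl⟩ hx, x, hx⟩⟩
  obtain ⟨N, hN, hs⟩ := hUd x
  refine ⟨N, hN, ?_⟩
  rintro i ⟨y, ⟨hyi, z, hz⟩, hyN⟩ j ⟨y', ⟨hyj, -⟩, hyN'⟩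
  have hij : D i = D j := congrArg Subtype.val (hs ⟨y, hyi, hyN⟩ ⟨y', hyj, hyN'⟩)
  exact hDd.eq_of_mem hz (hij ▸ hz)

theorem normalSpace (hX : IsCollectionwiseNormal X τ) (hτ : ℵ₀ ≤ τ) : NormalSpace X := by
  refine ⟨fun s t hs ht hst => ?_⟩
  let D : ULift.{u} Bool → Set X := fun b => cond b.down s t
  have hDc : ∀ b, IsClosed (D b) := by
    rintro ⟨_ | _⟩
    exacts [ht, hs]
  have hDd : IsDiscreteFamily D := by
    refine .of_locallyFinite (locallyFinite_of_finite D) hDc ?_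
    rintro ⟨_ | _⟩ ⟨_ | _⟩ hbc
    exacts [absurd rfl hbc, hst.symm, hst, absurd rfl hbc]
  obtain ⟨U, hUo, hUd, hDU⟩ :=
    hX.exists_indexed_expansion ((Cardinal.lt_aleph0_of_finite _).le.trans hτ) hDc hDd
  refine ⟨U ⟨true⟩, U ⟨false⟩, hUo _, hUo _, hDU ⟨true⟩, hDU ⟨false⟩,
    Set.disjoint_left.2 fun x hs ht => ?_⟩
  simpa using hUd.eq_of_mem hs ht

theorem exists_locallyFinite_cover_encard_eq (hX : IsCollectionwiseNormal X τ) (hτ : ℵ₀ ≤ τ)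
    (hι : #ι ≤ τ) {A : Set X} (hA : IsClosed A) {W : ι → Set X} (hWo : ∀ i, IsOpen (W i))
    (hWA : A ⊆ ⋃ i, W i) {n : ℕ} (hn : ∀ x ∈ A, n ≤ {i | x ∈ W i}.encard) :
    ∃ V : ι → Set X, (∀ i, IsOpen (V i)) ∧ LocallyFinite V ∧ (∀ i, V i ⊆ W i) ∧
      ∀ x ∈ A, {i | x ∈ W i}.encard = n → x ∈ ⋃ i, V i := by
  have hcard : #{S : Finset ι // S.card = n} ≤ τ := by
    refine (Cardinal.mk_subtype_le _).trans ?_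
    rcases finite_or_infinite ι with h | h
    · exact (Cardinal.lt_aleph0_of_finite _).le.trans hτ
    · rwa [Cardinal.mk_finset_of_infinite]
  obtain ⟨U, hUo, hUd, hDU⟩ := hX.exists_indexed_expansion hcard
    (fun S => hA.inter (isClosed_setOf_mem_subset hWo S.1))
    (isDiscreteFamily_setOf_mem_subset hA hWo hn)
  refine ⟨fun i => (⋃ (S) (_ : i ∈ (S.1 : Set ι)), U S) ∩ W i,
    fun i => (isOpen_iUnion fun S => isOpen_iUnion fun _ => hUo S).inter (hWo i),
    (locallyFinite_iUnion_of_finite hUd.locallyFinite fun S => S.1.finite_toSet).subset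
      fun i => Set.inter_subset_left,
    fun i => Set.inter_subset_right, fun x hx hxn => ?_⟩
  obtain ⟨S, hS⟩ := (Set.finite_of_encard_eq_coe hxn).exists_finset_coe
  have hSn : S.card = n := by
    rwa [← hS, Set.encard_coe_eq_coe_finsetCard, Nat.cast_inj] at hxn
  obtain ⟨i, hi⟩ := Set.mem_iUnion.1 (hWA hx)
  exact Set.mem_iUnion.2 ⟨i, Set.mem_iUnion₂.2
    ⟨⟨S, hSn⟩, hS.superset hi, hDU ⟨S, hSn⟩ ⟨hx, hS.superset⟩⟩, hi⟩

theorem exists_locallyFinite_cover_encard_lt (hX : IsCollectionwiseNormal X τ) (hτ : ℵ₀ ≤ τ)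
    (hι : #ι ≤ τ) {W : ι → Set X} (hWo : ∀ i, IsOpen (W i)) (hW : ⋃ i, W i = Set.univ) (n : ℕ) :
    ∃ V : ι → Set X, (∀ i, IsOpen (V i)) ∧ LocallyFinite V ∧ (∀ i, V i ⊆ W i) ∧
      ∀ x, {i | x ∈ W i}.encard < n → x ∈ ⋃ i, V i := by
  induction n with
  | zero =>
    exact ⟨fun _ => ∅, fun _ => isOpen_empty, fun x => ⟨Set.univ, Filter.univ_mem, by simp⟩,
      fun _ => Set.empty_subset _, fun x hx => absurd hx not_lt_zero⟩
  | succ n ih =>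
    obtain ⟨V, hVo, hVl, hVW, hV⟩ := ih
    obtain ⟨V', hVo', hVl', hVW', hV'⟩ := hX.exists_locallyFinite_cover_encard_eq hτ hι
      (isOpen_iUnion hVo).isClosed_compl hWo (hW ▸ Set.subset_univ _)
      fun x hx => le_of_not_gt fun h => hx (hV x h)
    refine ⟨fun i => V i ∪ V' i, fun i => (hVo i).union (hVo' i), locallyFinite_union hVl hVl',
      fun i => Set.union_subset (hVW i) (hVW' i), fun x hx => ?_⟩
    rw [Set.iUnion_union_distrib]
    by_cases hxV : x ∈ ⋃ i, V i
    · exact Or.inl hxV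
    · refine Or.inr (hV' x hxV (le_antisymm ?_ (le_of_not_gt fun h => hxV (hV x h))))
      rw [Nat.cast_add_one] at hx
      exact ENat.lt_natCast_add_one_iff.1 hx

/-- For `Z = ∅` this is the Michael–Nagami theorem that point-finite open covers have locally finite
open refinements. -/
theorem exists_locallyFinite_refinement (hX : IsCollectionwiseNormal X τ)
    (hc : IsCountablyParacompact X) (hτ : ℵ₀ ≤ τ) (hι : #ι ≤ τ) {W Z : ι → Set X}
    (hWo : ∀ i, IsOpen (W i)) (hW : ⋃ i, W i = Set.univ) (hZo : ∀ i, IsOpen (Z i))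
    (hZl : LocallyFinite Z) (hZW : ∀ i, Z i ⊆ W i)
    (hfin : ∀ x ∉ ⋃ i, Z i, {i | x ∈ W i}.Finite) :
    ∃ V : ι → Set X, (∀ i, IsOpen (V i)) ∧ LocallyFinite V ∧ ⋃ i, V i = Set.univ ∧
      ∀ i, V i ⊆ W i := by
  choose V hVo hVl hVW hV using hX.exists_locallyFinite_cover_encard_lt hτ hι hWo hW
  have hcover : ⋃ n : ℕ, ⋃ i, V n i ∪ Z i = Set.univ := by
    refine Set.eq_univ_of_forall fun x => Set.mem_iUnion.2 ?_
    simp only [Set.iUnion_union_distrib]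
    by_cases hx : x ∈ ⋃ i, Z i
    · exact ⟨0, Or.inr hx⟩
    · obtain ⟨n, hn⟩ := ENat.ne_top_iff_exists.1 (Set.encard_ne_top_iff.2 (hfin x hx))
      refine ⟨n + 1, Or.inl (hV (n + 1) x ?_)⟩
      rw [← hn]
      exact_mod_cast n.lt_succ_self
  obtain ⟨V', hVo', hVl', hVc', hVW'⟩ := hc.exists_locallyFinite_merge
    (fun n i => (hVo n i).union (hZo i)) (fun n => locallyFinite_union (hVl n) hZl) hcover
  exact ⟨V', hVo', hVl', hVc', fun i => (hVW' i).trans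
    (Set.iUnion_subset fun n => Set.union_subset (hVW n i) (hZW i))⟩

end IsCollectionwiseNormal

theorem exists_continuous_mem_convexHull_of_locallyFinite {X ι E : Type*} [TopologicalSpace X]
    [NormalSpace X] [AddCommGroup E] [Module ℝ E] [TopologicalSpace E] [ContinuousAdd E]
    [ContinuousSMul ℝ E] {V : ι → Set X} (hVo : ∀ i, IsOpen (V i)) (hVl : LocallyFinite V)
    (hV : ⋃ i, V i = Set.univ) (y : ι → E) :
    ∃ f : X → E, Continuous f ∧ ∀ x, f x ∈ convexHull ℝ (y '' {i | x ∈ V i}) := by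
  obtain ⟨p, hp⟩ := PartitionOfUnity.exists_isSubordinate_of_locallyFinite isClosed_univ V hVo hVl
    hV.ge
  refine ⟨fun x => ∑ᶠ i, p i x • y i, p.continuous_finsum_smul fun _ _ _ => continuousAt_const,
    fun x => p.finsum_smul_mem_convex (g := fun i _ => y i) (Set.mem_univ x) (fun i hi => ?_)
      (convex_convexHull ℝ _)⟩
  exact subset_convexHull ℝ _ ⟨i, hp i (subset_closure hi), rfl⟩

theorem exists_dense_mk_le_topologicalWeight (E : Type u) [TopologicalSpace E] :
    ∃ s : Set E, Dense s ∧ #s ≤ topologicalWeight E := by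
  obtain ⟨B, hB, hBc⟩ : topologicalWeight E ∈
      {κ | ∃ B : Set (Set E), TopologicalSpace.IsTopologicalBasis B ∧ #B = κ} :=
    csInf_mem ⟨_, _, TopologicalSpace.isTopologicalBasis_opens, rfl⟩
  choose y hy using fun b : {b : B // (b : Set E).Nonempty} => b.2
  refine ⟨Set.range y, ?_, (Cardinal.mk_range_le.trans (Cardinal.mk_subtype_le _)).trans hBc.le⟩
  rw [hB.dense_iff]
  exact fun o ho hne => ⟨y ⟨⟨o, ho⟩, hne⟩, hy ⟨⟨o, ho⟩, hne⟩, Set.mem_range_self _⟩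

theorem exists_locallyFinite_cover_dist_lt (E : Type u) [PseudoMetricSpace E] {ε : ℝ}
    (hε : 0 < ε) :
    ∃ (ι : Type u) (U : ι → Set E), #ι ≤ topologicalWeight E ∧ (∀ i, IsOpen (U i)) ∧
      LocallyFinite U ∧ ⋃ i, U i = Set.univ ∧ ∀ i, ∀ y ∈ U i, ∀ z ∈ U i, dist y z < ε := by
  obtain ⟨s, hs, hsc⟩ := exists_dense_mk_le_topologicalWeight E
  have hcover : ⋃ y : s, Metric.ball (y : E) (ε / 2) = Set.univ := by
    refine Set.eq_univ_of_forall fun x => ?_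
    obtain ⟨y, hy, hxy⟩ := hs.exists_dist_lt x (half_pos hε)
    exact Set.mem_iUnion.2 ⟨⟨y, hy⟩, hxy⟩
  obtain ⟨U, hUo, hUc, hUl, hU⟩ := precise_refinement _ (fun _ => Metric.isOpen_ball) hcover
  refine ⟨s, U, hsc, hUo, hUl, hUc, fun i y hy z hz => ?_⟩
  calc dist y z ≤ dist y i + dist z i := dist_triangle_right y z i
    _ < ε / 2 + ε / 2 := add_lt_add (hU i hy) (hU i hz)
    _ = ε := add_halves ε

theorem isOpen_setOf_nonempty_inter_of_hasOpenCGraph {X E : Type*} [TopologicalSpace X]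
    [TopologicalSpace E] {φ ψ : X → Set E} (hφ : LowerHemicontinuous φ) (hψ : HasOpenCGraph ψ) :
    IsOpen {x | (φ x ∩ ψ x).Nonempty} := by
  simpa only [Set.inter_univ] using
    lowerHemicontinuous_iff_isOpen_inter_nonempty.1 (hφ.inter_hasOpenCGraph hψ) _ isOpen_univ

theorem lowerHemicontinuous_image {X E F : Type*} [TopologicalSpace X] [TopologicalSpace E]
    [TopologicalSpace F] {φ : X → Set E} (hφ : LowerHemicontinuous φ) {h : X → E → F}
    (hh : Continuous (Function.uncurry h)) : LowerHemicontinuous fun x => h x '' φ x := by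
  refine lowerHemicontinuous_iff_isOpen_inter_nonempty.2 fun U hU => ?_
  simp only [Set.image_inter_nonempty_iff]
  exact isOpen_setOf_nonempty_inter_of_hasOpenCGraph hφ (hU.preimage hh)

theorem upperSemicontinuous_infDist {X E : Type*} [TopologicalSpace X] [PseudoMetricSpace E]
    {φ : X → Set E} (hφ : LowerHemicontinuous φ) (hne : ∀ x, (φ x).Nonempty) {g : X → E}
    (hg : Continuous g) : UpperSemicontinuous fun x => Metric.infDist (g x) (φ x) := by
  refine upperSemicontinuous_iff_isOpen_preimage.2 fun r => ?_
  have hball : HasOpenCGraph fun x => {y | dist (g x) y < r} :=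
    isOpen_lt ((hg.comp continuous_fst).dist continuous_snd) continuous_const
  convert isOpen_setOf_nonempty_inter_of_hasOpenCGraph hφ hball using 1
  exact Set.ext fun x => Metric.infDist_lt_iff (hne x)

/-- Dowker's insertion theorem. -/
theorem IsCountablyParacompact.exists_continuous_between {X : Type*} [TopologicalSpace X]
    [NormalSpace X] (hX : IsCountablyParacompact X) {u l : X → ℝ} (hu : UpperSemicontinuous u)
    (hl : LowerSemicontinuous l) (hul : ∀ x, u x < l x) :
    ∃ α : X → ℝ, Continuous α ∧ ∀ x, u x < α x ∧ α x < l x := by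
  have hcover : ⋃ q : ℚ, {x | u x < q} ∩ {x | (q : ℝ) < l x} = Set.univ :=
    Set.eq_univ_of_forall fun x => Set.mem_iUnion.2 (exists_rat_btwn (hul x))
  obtain ⟨V, hVo, hVl, hVc, hV⟩ := hX.exists_precise_refinement
    (fun q : ℚ => (hu.isOpen_preimage q).inter (hl.isOpen_preimage q)) hcover
  obtain ⟨α, hα, hαV⟩ :=
    exists_continuous_mem_convexHull_of_locallyFinite hVo hVl hVc fun q : ℚ => (q : ℝ)
  refine ⟨α, hα, fun x => convexHull_min ?_ (convex_Ioo (u x) (l x)) (hαV x)⟩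
  rintro _ ⟨q, hq, rfl⟩
  exact hV q hq

section CompactsOrUniv

variable {E F : Type*} [TopologicalSpace E] [TopologicalSpace F] {S : Set E}

theorem nonempty_of_mem_compactsOrUniv [Nonempty E] (hS : S ∈ compactsOrUniv E) : S.Nonempty := by
  obtain ⟨hS, -⟩ | rfl := hS
  exacts [hS, Set.univ_nonempty]

theorem isClosed_of_mem_compactsOrUniv (hS : S ∈ compactsOrUniv E) : IsClosed S := by
  obtain ⟨-, hS, -⟩ | rfl := hS
  exacts [hS, isClosed_univ]

theorem image_mem_compactsOrUniv [T2Space F] (hS : S ∈ compactsOrUniv E) {h : E → F}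
    (hh : Continuous h) (hs : Function.Surjective h) : h '' S ∈ compactsOrUniv F := by
  obtain ⟨hne, -, hK⟩ | rfl := hS
  · exact Or.inl ⟨hne.image h, (hK.image hh).isClosed, hK.image hh⟩
  · exact Or.inr (Set.image_univ_of_surjective hs)

end CompactsOrUniv

theorem exists_tendstoUniformly_of_dist_le {X E : Type*} [PseudoMetricSpace E] [CompleteSpace E]
    {F : ℕ → X → E} {d : ℕ → ℝ} (hd : Summable d)
    (hF : ∀ n x, dist (F n x) (F (n + 1) x) ≤ d n) :
    ∃ f : X → E, TendstoUniformly F f Filter.atTop := by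
  choose f hf using fun x => cauchySeq_tendsto_of_complete
    (cauchySeq_of_dist_le_of_summable d (hF · x) hd)
  refine ⟨f, Metric.tendstoUniformly_iff.2 fun ε hε => ?_⟩
  filter_upwards [(tendsto_sum_nat_add d).eventually_lt_const hε] with n hn x
  calc dist (f x) (F n x) = dist (F n x) (f x) := dist_comm _ _
    _ ≤ ∑' m, d (n + m) := dist_le_tsum_of_dist_le_of_tendsto d (hF · x) hd (hf x) n
    _ < ε := by simpa only [add_comm] using hn

theorem mem_closure_of_tendsto_of_mem_thickening {E ι : Type*} [PseudoMetricSpace E] {S : Set E}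
    {l : Filter ι} [l.NeBot] {u : ι → E} {δ : ι → ℝ} {a : E} (hu : Filter.Tendsto u l (𝓝 a))
    (hδ : Filter.Tendsto δ l (𝓝 0)) (h : ∀ n, u n ∈ Metric.thickening (δ n) S) :
    a ∈ closure S := by
  choose z hz hzu using fun n => Metric.mem_thickening_iff.1 (h n)
  have hdist : Filter.Tendsto (fun n => dist (u n) (z n)) l (𝓝 0) :=
    squeeze_zero (fun _ => dist_nonneg) (fun n => (hzu n).le) hδ
  exact mem_closure_of_tendsto ((tendsto_iff_of_dist hdist).1 hu) (Filter.Eventually.of_forall hz)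

section Selection

variable {X E : Type u} [TopologicalSpace X] {τ : Cardinal.{u}} {Φ φ : X → Set E} {f : X → E}

/-- The sets `{x | (Φ x ∩ U i).Nonempty}` need not be point-finite where `Φ x` lies in no compact
set; there the locally finite family `f ⁻¹' U i` replaces them. -/
theorem exists_locallyFinite_cover_nonempty_inter [TopologicalSpace E]
    (hX : IsCollectionwiseNormal X τ) (hc : IsCountablyParacompact X) (hτ : ℵ₀ ≤ τ)
    (hΦ : LowerHemicontinuous Φ) (hne : ∀ x, (Φ x).Nonempty) (hf : Continuous f)
    (hfΦ : ∀ x, (∃ K, IsCompact K ∧ Φ x ⊆ K) ∨ f x ∈ Φ x) {ι : Type u} (hι : #ι ≤ τ)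
    {U : ι → Set E} (hUo : ∀ i, IsOpen (U i)) (hUl : LocallyFinite U)
    (hU : ⋃ i, U i = Set.univ) :
    ∃ V : ι → Set X, (∀ i, IsOpen (V i)) ∧ LocallyFinite V ∧ ⋃ i, V i = Set.univ ∧
      ∀ i, ∀ x ∈ V i, (Φ x ∩ U i).Nonempty := by
  have hUmem : ∀ y, ∃ i, y ∈ U i := Set.iUnion_eq_univ_iff.1 hU
  have hWo : ∀ i, IsOpen {x | (Φ x ∩ U i).Nonempty} := fun i =>
    lowerHemicontinuous_iff_isOpen_inter_nonempty.1 hΦ _ (hUo i)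
  have hW : ⋃ i, {x | (Φ x ∩ U i).Nonempty} = Set.univ := by
    refine Set.iUnion_eq_univ_iff.2 fun x => ?_
    obtain ⟨y, hy⟩ := hne x
    exact (hUmem y).imp fun i hi => ⟨y, hy, hi⟩
  refine hX.exists_locallyFinite_refinement (Z := fun i => f ⁻¹' U i ∩ {x | (Φ x ∩ U i).Nonempty})
    hc hτ hι hWo hW (fun i => ((hUo i).preimage hf).inter (hWo i))
    ((hUl.preimage_continuous hf).subset fun i => Set.inter_subset_left)
    (fun i => Set.inter_subset_right) fun x hx => ?_
  rcases hfΦ x with ⟨K, hK, hΦK⟩ | hfx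
  · refine (hUl.finite_nonempty_inter_compact hK).subset ?_
    rintro i ⟨y, hy, hyU⟩
    exact ⟨y, hyU, hΦK hy⟩
  · obtain ⟨i, hi⟩ := hUmem (f x)
    exact (hx (Set.mem_iUnion.2 ⟨i, hi, f x, hfx, hi⟩)).elim

variable [NormedAddCommGroup E] [NormedSpace ℝ E]

theorem exists_continuous_mem_convexHull_inter_thickening (hX : IsCollectionwiseNormal X τ)
    (hc : IsCountablyParacompact X) (hτ : ℵ₀ ≤ τ) (hE : topologicalWeight E ≤ τ)
    (hΦ : LowerHemicontinuous Φ) (hconv : ∀ x, Convex ℝ (Φ x)) (hne : ∀ x, (Φ x).Nonempty)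
    (hf : Continuous f) (hfΦ : ∀ x, (∃ K, IsCompact K ∧ Φ x ⊆ K) ∨ f x ∈ Φ x) {ε : ℝ}
    (hε : 0 < ε) :
    ∃ f' : X → E, Continuous f' ∧
      ∀ x, f' x ∈ convexHull ℝ (⋃ x, Φ x) ∩ Metric.thickening ε (Φ x) := by
  have := hX.normalSpace hτ
  obtain ⟨ι, U, hι, hUo, hUl, hU, hUε⟩ := exists_locallyFinite_cover_dist_lt E hε
  obtain ⟨V, hVo, hVl, hV, hVU⟩ := exists_locallyFinite_cover_nonempty_inter hX hc hτ hΦ hne hf hfΦ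
    (hι.trans hE) hUo hUl hU
  have hy : ∀ i, ∃ y, ∀ x ∈ V i, y ∈ (⋃ x, Φ x) ∩ U i := fun i => by
    rcases (V i).eq_empty_or_nonempty with h | ⟨x, hx⟩
    · exact ⟨0, fun x hx => absurd (h ▸ hx) (Set.notMem_empty x)⟩
    · obtain ⟨y, hyΦ, hyU⟩ := hVU i x hx
      exact ⟨y, fun _ _ => ⟨Set.mem_iUnion.2 ⟨x, hyΦ⟩, hyU⟩⟩
  choose y hy using hy
  obtain ⟨f', hf', hf'V⟩ := exists_continuous_mem_convexHull_of_locallyFinite hVo hVl hV y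
  refine ⟨f', hf', fun x => ⟨convexHull_mono ?_ (hf'V x),
    convexHull_min ?_ ((hconv x).thickening ε) (hf'V x)⟩⟩
  · rintro _ ⟨i, hi, rfl⟩
    exact (hy i x hi).1
  · rintro _ ⟨i, hi, rfl⟩
    obtain ⟨z, hz, hzU⟩ := hVU i x hi
    exact Metric.mem_thickening_iff.2 ⟨z, hz, hUε i _ (hy i x hi).2 _ hzU⟩

theorem exists_continuous_mem_thickening_dist_le (hX : IsCollectionwiseNormal X τ)
    (hc : IsCountablyParacompact X) (hτ : ℵ₀ ≤ τ) (hE : topologicalWeight E ≤ τ)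
    (hφ : ∀ x, φ x ∈ compactsOrUniv E) (hl : LowerHemicontinuous φ)
    (hconv : ∀ x, Convex ℝ (φ x)) {C : Set E} (hCo : IsOpen C) (hC : Convex ℝ C) {δ ε : ℝ}
    (hδ : 0 < δ) (hε : 0 < ε) (hf : Continuous f)
    (hfφ : ∀ x, f x ∈ C ∩ Metric.thickening δ (φ x ∩ C)) :
    ∃ f' : X → E, Continuous f' ∧ (∀ x, f' x ∈ C ∩ Metric.thickening ε (φ x ∩ C)) ∧
      ∀ x, dist (f x) (f' x) ≤ δ + ε := by
  let Φ : X → Set E := fun x => φ x ∩ (C ∩ Metric.ball (f x) δ)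
  have hopen : HasOpenCGraph fun x => C ∩ Metric.ball (f x) δ :=
    (hCo.preimage continuous_snd).inter
      (isOpen_lt (continuous_snd.dist (hf.comp continuous_fst)) continuous_const)
  have hne : ∀ x, (Φ x).Nonempty := fun x => by
    obtain ⟨z, hz, hfz⟩ := Metric.mem_thickening_iff.1 (hfφ x).2
    exact ⟨z, hz.1, hz.2, Metric.mem_ball'.2 hfz⟩
  have hfΦ : ∀ x, (∃ K, IsCompact K ∧ Φ x ⊆ K) ∨ f x ∈ Φ x := fun x => by
    rcases hφ x with ⟨-, -, hK⟩ | h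
    · exact Or.inl ⟨φ x, hK, Set.inter_subset_left⟩
    · exact Or.inr ⟨h.superset trivial, (hfφ x).1, Metric.mem_ball_self hδ⟩
  obtain ⟨f', hf', hf'Φ⟩ := exists_continuous_mem_convexHull_inter_thickening hX hc hτ hE
    (hl.inter_hasOpenCGraph hopen) (fun x => (hconv x).inter (hC.inter (convex_ball _ _))) hne hf
    hfΦ hε
  refine ⟨f', hf', fun x => ⟨convexHull_min ?_ hC (hf'Φ x).1, ?_⟩, fun x => ?_⟩
  · exact Set.iUnion_subset fun x y hy => hy.2.1
  · exact Metric.thickening_subset_of_subset ε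
      (Set.inter_subset_inter_right _ Set.inter_subset_left) (hf'Φ x).2
  · obtain ⟨z, hz, hf'z⟩ := Metric.mem_thickening_iff.1 (hf'Φ x).2
    calc dist (f x) (f' x) ≤ dist (f x) z + dist (f' x) z := dist_triangle_right _ _ z
      _ ≤ δ + ε := add_le_add (Metric.mem_ball'.1 hz.2.2).le hf'z.le

theorem exists_continuous_mem_closure_inter [CompleteSpace E] (hX : IsCollectionwiseNormal X τ)
    (hc : IsCountablyParacompact X) (hτ : ℵ₀ ≤ τ) (hE : topologicalWeight E ≤ τ)
    (hφ : ∀ x, φ x ∈ compactsOrUniv E) (hl : LowerHemicontinuous φ)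
    (hconv : ∀ x, Convex ℝ (φ x)) {C : Set E} (hCo : IsOpen C) (hC : Convex ℝ C) {r : ℝ}
    (hr : 0 < r) (hf : Continuous f) (hfφ : ∀ x, f x ∈ C ∩ Metric.thickening r (φ x ∩ C)) :
    ∃ f' : X → E, Continuous f' ∧ ∀ x, f' x ∈ closure (φ x ∩ C) := by
  let δ : ℕ → ℝ := fun n => r * (1 / 2) ^ n
  have hδ : Summable δ := summable_geometric_two.mul_left r
  have hδ0 : ∀ n, 0 < δ n := fun n => by positivity
  let A : ℕ → Set (X → E) := fun n =>
    {f | Continuous f ∧ ∀ x, f x ∈ C ∩ Metric.thickening (δ n) (φ x ∩ C)}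
  have hstep : ∀ n (f : A n), ∃ f' : A (n + 1), ∀ x, dist (f.1 x) (f'.1 x) ≤ δ n + δ (n + 1) := by
    rintro n ⟨f, hf, hfφ⟩
    obtain ⟨f', hf', hf'φ, hd⟩ := exists_continuous_mem_thickening_dist_le hX hc hτ hE hφ hl hconv
      hCo hC (hδ0 n) (hδ0 (n + 1)) hf hfφ
    exact ⟨⟨f', hf', hf'φ⟩, hd⟩
  choose next hnext using hstep
  let F : ∀ n, A n := fun n => Nat.rec ⟨f, hf, by simpa [δ] using hfφ⟩ next n
  obtain ⟨f', hf'⟩ := exists_tendstoUniformly_of_dist_le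
    (hδ.add ((summable_nat_add_iff 1).2 hδ)) (F := fun n => (F n).1) fun n => hnext n (F n)
  exact ⟨f', hf'.continuous (Filter.Frequently.of_forall fun n => (F n).2.1), fun x =>
    mem_closure_of_tendsto_of_mem_thickening (hf'.tendsto_at x) hδ.tendsto_atTop_zero
      fun n => ((F n).2.2 x).2⟩

theorem exists_selection_norm_le_one [CompleteSpace E] (hX : IsCollectionwiseNormal X τ)
    (hc : IsCountablyParacompact X) (hτ : ℵ₀ ≤ τ) (hE : topologicalWeight E ≤ τ)
    (hφ : ∀ x, φ x ∈ compactsOrUniv E) (hl : LowerHemicontinuous φ)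
    (hconv : ∀ x, Convex ℝ (φ x)) (hne : ∀ x, (φ x ∩ Metric.ball 0 1).Nonempty) :
    ∃ f : X → E, Continuous f ∧ IsSelection f φ ∧ ∀ x, ‖f x‖ ≤ 1 := by
  have h0 : ∀ x, (0 : E) ∈ Metric.ball 0 1 ∩ Metric.thickening 1 (φ x ∩ Metric.ball 0 1) :=
    fun x => by
      obtain ⟨y, hy, hy1⟩ := hne x
      exact ⟨Metric.mem_ball_self one_pos,
        Metric.mem_thickening_iff.2 ⟨y, ⟨hy, hy1⟩, Metric.mem_ball'.1 hy1⟩⟩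
  obtain ⟨f, hf, hfφ⟩ := exists_continuous_mem_closure_inter hX hc hτ hE hφ hl hconv
    Metric.isOpen_ball (convex_ball 0 1) one_pos continuous_const h0
  refine ⟨f, hf, fun x => ?_, fun x => ?_⟩
  · exact (isClosed_of_mem_compactsOrUniv (hφ x)).closure_subset
      (closure_mono Set.inter_subset_left (hfφ x))
  · exact mem_closedBall_zero_iff.1
      (Metric.closure_ball_subset_closedBall (closure_mono Set.inter_subset_right (hfφ x)))

theorem exists_selection_dist_lt [CompleteSpace E] (hX : IsCollectionwiseNormal X τ)
    (hc : IsCountablyParacompact X) (hτ : ℵ₀ ≤ τ) (hE : topologicalWeight E ≤ τ)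
    (hφ : ∀ x, φ x ∈ compactsOrUniv E) (hl : LowerHemicontinuous φ)
    (hconv : ∀ x, Convex ℝ (φ x)) {η : X → ℝ} (hη : LowerSemicontinuous η) {g : X → E}
    (hg : Continuous g) (hgφ : IsApproxSelection g η φ) :
    ∃ f : X → E, Continuous f ∧ IsSelection f φ ∧ ∀ x, dist (f x) (g x) < η x := by
  have := hX.normalSpace hτ
  have hne : ∀ x, (φ x).Nonempty := fun x => nonempty_of_mem_compactsOrUniv (hφ x)
  obtain ⟨α, hα, hαφ⟩ :=
    hc.exists_continuous_between (upperSemicontinuous_infDist hl hne hg) hη hgφ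
  have hα0 : ∀ x, 0 < α x := fun x => Metric.infDist_nonneg.trans_lt (hαφ x).1
  -- `h x` turns `g x` into the origin and `ball (g x) (α x)` into the unit ball.
  let h : X → E → E := fun x y => (α x)⁻¹ • (y - g x)
  have hcont : Continuous (Function.uncurry h) :=
    ((hα.inv₀ fun x => (hα0 x).ne').comp continuous_fst).smul
      (continuous_snd.sub (hg.comp continuous_fst))
  have hinv : ∀ x z, h x (g x + α x • z) = z := fun x z => by
    simp only [h, add_sub_cancel_left, inv_smul_smul₀ (hα0 x).ne']
  have hinj : ∀ x, Function.Injective (h x) := fun x y z hyz =>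
    sub_left_injective (smul_right_injective E (inv_ne_zero (hα0 x).ne') hyz)
  have hball : ∀ x, (h x '' φ x ∩ Metric.ball 0 1).Nonempty := fun x => by
    obtain ⟨y, hy, hgy⟩ := (Metric.infDist_lt_iff (hne x)).1 (hαφ x).1
    refine ⟨h x y, ⟨y, hy, rfl⟩, ?_⟩
    rwa [mem_ball_zero_iff, norm_smul, norm_inv, Real.norm_of_nonneg (hα0 x).le,
      inv_mul_lt_one₀ (hα0 x), ← dist_eq_norm']
  obtain ⟨f, hf, hfφ, hf1⟩ := exists_selection_norm_le_one hX hc hτ hE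
    (fun x => image_mem_compactsOrUniv (hφ x) (hcont.uncurry_left x)
      fun z => ⟨g x + α x • z, hinv x z⟩)
    (lowerHemicontinuous_image hl hcont)
    (fun x => (hconv x).affine_image ((α x)⁻¹ • (AffineMap.id ℝ E - AffineMap.const ℝ E (g x))))
    hball
  refine ⟨fun x => g x + α x • f x, hg.add (hα.smul hf), fun x => ?_, fun x => ?_⟩
  · exact (hinj x).mem_set_image.1 ((hinv x (f x)).symm ▸ hfφ x)
  · rw [dist_self_add_left, norm_smul, Real.norm_of_nonneg (hα0 x).le]
    exact (mul_le_of_le_one_right (hα0 x).le (hf1 x)).trans_lt (hαφ x).2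

end Selection

section Weight

theorem topologicalWeight_le_aleph0 (E : Type u) [TopologicalSpace E]
    [SecondCountableTopology E] : topologicalWeight E ≤ ℵ₀ := by
  obtain ⟨B, hBc, -, hB⟩ := TopologicalSpace.exists_countable_basis E
  exact (csInf_le' ⟨B, hB, rfl⟩ : topologicalWeight E ≤ #B).trans hBc.le_aleph0

theorem mk_prod_le_of_countable (α : Type u) (β : Type) [Countable β] :
    #(α × β) ≤ max ℵ₀ #α := by
  calc #(α × β) = #α * Cardinal.lift.{u} #β := by rw [Cardinal.mk_prod, Cardinal.lift_uzero]
    _ ≤ #α * ℵ₀ := by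
      gcongr
      exact Cardinal.lift_le_aleph0.2 Cardinal.mk_le_aleph0
    _ ≤ max ℵ₀ #α := by simpa [max_comm] using Cardinal.mul_le_max #α ℵ₀

theorem topologicalWeight_le_max_of_dense {E : Type u} [PseudoMetricSpace E] {s : Set E}
    (hs : Dense s) : topologicalWeight E ≤ max ℵ₀ #s := by
  let b : s × ℚ → Set E := fun p => Metric.ball (p.1 : E) p.2
  have hb : TopologicalSpace.IsTopologicalBasis (Set.range b) := by
    refine TopologicalSpace.isTopologicalBasis_of_isOpen_of_nhds
      (Set.forall_mem_range.2 fun p => Metric.isOpen_ball) fun x U hx hU => ?_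
    obtain ⟨ε, hε, hεU⟩ := Metric.isOpen_iff.1 hU x hx
    obtain ⟨q, hq0, hq⟩ := exists_rat_btwn (half_pos hε)
    obtain ⟨y, hy, hxy⟩ := hs.exists_dist_lt x hq0
    refine ⟨b (⟨y, hy⟩, q), Set.mem_range_self _, hxy, (Metric.ball_subset ?_).trans hεU⟩
    rw [dist_comm]
    linarith
  calc topologicalWeight E ≤ #(Set.range b) := csInf_le' ⟨Set.range b, hb, rfl⟩
    _ ≤ #(s × ℚ) := Cardinal.mk_range_le
    _ ≤ max ℵ₀ #s := mk_prod_le_of_countable s ℚ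

theorem mk_addSubmonoid_closure_le {M : Type u} [AddMonoid M] (s : Set M) :
    #(AddSubmonoid.closure s) ≤ max ℵ₀ #s := by
  rw [AddSubmonoid.closure_eq_mrange]
  exact (Cardinal.mk_range_le (f := FreeAddMonoid.lift ((↑) : s → M))).trans
    (Cardinal.mk_list_le_max s)

variable {ι : Type u} {p : ENNReal} [Fact (1 ≤ p)]

theorem dense_addSubmonoid_closure_lp_single [DecidableEq ι] (hp : p ≠ ⊤) :
    Dense (AddSubmonoid.closure (Set.range fun iq : ι × ℚ =>
      (lp.single p iq.1 (iq.2 : ℝ) : lp (fun _ : ι => ℝ) p)) : Set (lp (fun _ : ι => ℝ) p)) := by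
  set M := AddSubmonoid.closure (Set.range fun iq : ι × ℚ =>
      (lp.single p iq.1 (iq.2 : ℝ) : lp (fun _ : ι => ℝ) p))
  have hM : ∀ (i : ι) (r : ℝ), lp.single p i r ∈ M.topologicalClosure := fun i r => by
    refine map_mem_closure (lp.isometry_single (E := fun _ : ι => ℝ) i).continuous
      (Rat.denseRange_cast r) (Set.forall_mem_range.2 fun q => ?_)
    exact AddSubmonoid.subset_closure ⟨(i, q), rfl⟩
  exact fun x => M.isClosed_topologicalClosure.mem_of_tendsto (lp.hasSum_single hp x)
    (Filter.Eventually.of_forall fun s => sum_mem fun i _ => hM i (x i))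

theorem topologicalWeight_lp_le (hp : p ≠ ⊤) :
    topologicalWeight (lp (fun _ : ι => ℝ) p) ≤ max ℵ₀ #ι := by
  classical
  refine (topologicalWeight_le_max_of_dense (dense_addSubmonoid_closure_lp_single hp)).trans
    (max_le (le_max_left _ _) ((mk_addSubmonoid_closure_le _).trans (max_le (le_max_left _ _) ?_)))
  exact Cardinal.mk_range_le.trans (mk_prod_le_of_countable ι ℚ)

end Weight

section PinnedMap

variable {X ι E : Type*} [TopologicalSpace X] {D : ι → Set X} {e : ι → E}

/-- The set-valued map whose selections are the functions that take the constant value `e i` on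
`D i` for every `i`. -/
def pinnedMap (D : ι → Set X) (e : ι → E) (x : X) : Set E := {y | ∀ i, x ∈ D i → y = e i}

theorem pinnedMap_eq_singleton_or_univ (hD : IsDiscreteFamily D) (e : ι → E) (x : X) :
    (∃ i, pinnedMap D e x = {e i}) ∨ pinnedMap D e x = Set.univ := by
  by_cases h : ∃ i, x ∈ D i
  · obtain ⟨i, hi⟩ := h
    refine Or.inl ⟨i, Set.Subset.antisymm (fun y hy => hy i hi) ?_⟩
    rintro _ rfl j hj
    rw [hD.eq_of_mem hi hj]
  · exact Or.inr (Set.eq_univ_of_forall fun y i hi => absurd ⟨i, hi⟩ h)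

theorem lowerHemicontinuous_pinnedMap [TopologicalSpace E] (hl : LocallyFinite D)
    (hc : ∀ i, IsClosed (D i)) (e : ι → E) : LowerHemicontinuous (pinnedMap D e) := by
  refine lowerHemicontinuous_iff_isOpen_inter_nonempty.2 fun U _ => isOpen_iff_mem_nhds.2 ?_
  rintro x ⟨y, hy, hyU⟩
  filter_upwards [hl.iInter_compl_mem_nhds hc x] with z hz
  exact ⟨y, fun i hi => hy i (by_contra fun hx => Set.mem_iInter₂.1 hz i hx hi), hyU⟩

end PinnedMap

theorem lowerHemicontinuous_Icc {X : Type*} [TopologicalSpace X] {a b : X → ℝ}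
    (ha : UpperSemicontinuous a) (hb : LowerSemicontinuous b) (hab : ∀ x, a x < b x) :
    LowerHemicontinuous fun x => Set.Icc (a x) (b x) := by
  refine lowerHemicontinuous_iff_isOpen_inter_nonempty.2 fun U hU => ?_
  have h : {x | (Set.Icc (a x) (b x) ∩ U).Nonempty} = ⋃ y ∈ U, {x | a x < y} ∩ {x | y < b x} := by
    ext x
    simp only [Set.mem_iUnion]
    rw [Set.mem_ofPred_eq, ← closure_Ioo (hab x).ne, closure_inter_open_nonempty_iff hU]
    exact ⟨fun ⟨y, hy, hyU⟩ => ⟨y, hyU, hy⟩, fun ⟨y, hyU, hy⟩ => ⟨y, hy, hyU⟩⟩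
  exact h ▸ isOpen_biUnion fun y _ => (ha.isOpen_preimage y).inter (hb.isOpen_preimage y)

theorem isCountablyParacompact_of_forall_exists_continuous_ge {X : Type*} [TopologicalSpace X]
    (hX : ∀ a : X → ℝ, UpperSemicontinuous a → ∃ h : X → ℝ, Continuous h ∧ ∀ x, a x ≤ h x) :
    IsCountablyParacompact X := by
  classical
  intro 𝒰 h𝒰 hUo hUc
  rcases 𝒰.eq_empty_or_nonempty with rfl | hne
  · exact ⟨∅, by simp, hUc, fun x => ⟨Set.univ, Filter.univ_mem, Set.toFinite _⟩, by simp⟩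
  obtain ⟨U, rfl⟩ := h𝒰.exists_eq_range hne
  rw [Set.forall_mem_range] at hUo
  have hex : ∀ x, ∃ n, x ∈ U n := Set.iUnion_eq_univ_iff.1 (Set.sUnion_range U ▸ hUc)
  let N : X → ℕ := fun x => Nat.find (hex x)
  have hN : UpperSemicontinuous fun x => (N x : ℝ) := fun x r hr => by
    filter_upwards [(hUo _).mem_nhds (Nat.find_spec (hex x))] with z hz
    exact (Nat.cast_le.2 (Nat.find_min' _ hz)).trans_lt hr
  obtain ⟨h, hh, hNh⟩ := hX _ hN
  let W : ℕ → Set X := fun n => U n ∩ {x | (n : ℝ) - 1 < h x}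
  have hWl : LocallyFinite W := fun x => by
    obtain ⟨m, hm⟩ := exists_nat_gt (h x)
    refine ⟨{z | h z < m}, (isOpen_lt hh continuous_const).mem_nhds hm,
      (Set.finite_le_nat m).subset ?_⟩
    rintro n ⟨z, ⟨-, hnz⟩, hzm⟩
    have hnm : (n : ℝ) < m + 1 := by linarith [Set.mem_ofPred.1 hnz, Set.mem_ofPred.1 hzm]
    exact Nat.lt_succ_iff.1 (by exact_mod_cast hnm)
  refine ⟨Set.range W, Set.forall_mem_range.2 fun n => (hUo n).inter
    (isOpen_lt continuous_const hh), ?_, hWl.on_range, Set.forall_mem_range.2 fun n =>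
    ⟨U n, Set.mem_range_self n, Set.inter_subset_left⟩⟩
  rw [Set.sUnion_range]
  exact Set.iUnion_eq_univ_iff.2 fun x => ⟨N x, Nat.find_spec (hex x),
    (sub_one_lt _).trans_le (hNh x)⟩

/-- Condition (b) of the theorem, as a property of `X` and `τ`. -/
def HasControlledSelections (X : Type u) [TopologicalSpace X] (τ : Cardinal.{u}) : Prop :=
  ∀ (E : Type u) [NormedAddCommGroup E] [NormedSpace ℝ E] [CompleteSpace E],
    topologicalWeight E ≤ τ →
    ∀ (φ : X → Set E) (η : X → ℝ) (g : X → E),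
      (∀ x, φ x ∈ compactsOrUniv E) → LowerHemicontinuous φ → (∀ x, Convex ℝ (φ x)) →
      LowerSemicontinuous η → (∀ x, 0 < η x) →
      Continuous g → IsApproxSelection g η φ →
      ∃ f : X → E, Continuous f ∧ IsSelection f φ ∧ ∀ x, dist (f x) (g x) < η x

namespace HasControlledSelections

variable {X : Type u} [TopologicalSpace X] {τ : Cardinal.{u}}

theorem exists_continuous_extension (hX : HasControlledSelections X τ) {E : Type u}
    [NormedAddCommGroup E] [NormedSpace ℝ E] [CompleteSpace E] (hE : topologicalWeight E ≤ τ)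
    {ι : Type*} {D : ι → Set X} (hDc : ∀ i, IsClosed (D i)) (hD : IsDiscreteFamily D) {e : ι → E}
    (he : Bornology.IsBounded (Set.range e)) :
    ∃ f : X → E, Continuous f ∧ ∀ i, ∀ x ∈ D i, f x = e i := by
  obtain ⟨R, hR, heR⟩ := he.exists_pos_norm_lt
  have hcase := pinnedMap_eq_singleton_or_univ hD e
  have hmem : ∀ x, pinnedMap D e x ∈ compactsOrUniv E := fun x => by
    obtain ⟨i, hi⟩ | h := hcase x
    · rw [hi]
      exact Or.inl ⟨Set.singleton_nonempty _, isClosed_singleton, isCompact_singleton⟩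
    · exact Or.inr h
  have hconv : ∀ x, Convex ℝ (pinnedMap D e x) := fun x => by
    obtain ⟨i, hi⟩ | h := hcase x
    · exact hi ▸ convex_singleton _
    · exact h ▸ convex_univ
  have happrox : IsApproxSelection (fun _ => 0) (fun _ => R) (pinnedMap D e) := fun x => by
    obtain ⟨i, hi⟩ | h := hcase x
    · rw [hi, Metric.infDist_singleton, dist_zero_left]
      exact heR _ (Set.mem_range_self i)
    · rwa [h, Metric.infDist_zero_of_mem (Set.mem_univ _)]
  obtain ⟨f, hf, hfD, -⟩ := hX E hE _ _ _ hmem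
    (lowerHemicontinuous_pinnedMap hD.locallyFinite hDc e) hconv lowerSemicontinuous_const
    (fun _ => hR) continuous_const happrox
  exact ⟨f, hf, fun i x hx => hfD x i hx⟩

theorem isCollectionwiseNormal [T1Space X] (hX : HasControlledSelections X τ) (hτ : ℵ₀ ≤ τ) :
    IsCollectionwiseNormal X τ := by
  classical
  refine ⟨inferInstance, fun 𝒟 hDc hD hDτ => ?_⟩
  let e : 𝒟 → lp (fun _ : 𝒟 => ℝ) 1 := fun D => lp.single 1 D 1
  have hbdd : Bornology.IsBounded (Set.range e) := by
    refine isBounded_iff_forall_norm_le.2 ⟨1, Set.forall_mem_range.2 fun D => ?_⟩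
    rw [lp.norm_single one_pos, norm_one]
  have hdist : Pairwise fun D D' => 4 * (1 / 4) ≤ dist (e D) (e D') := fun D D' h => by
    calc 4 * (1 / 4) = ‖(e D - e D') D‖ := by simp [e, h]
      _ ≤ dist (e D) (e D') := by
        rw [dist_eq_norm]
        exact lp.norm_apply_le_norm one_ne_zero _ D
  obtain ⟨f, hf, hfe⟩ := hX.exists_continuous_extension
    ((topologicalWeight_lp_le ENNReal.one_ne_top).trans (max_le hτ hDτ))
    (fun D : 𝒟 => hDc D D.2) hD hbdd
  refine ⟨fun D => f ⁻¹' Metric.ball (e D) (1 / 4), fun D => Metric.isOpen_ball.preimage hf,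
    (isDiscreteFamily_ball (by norm_num) hdist).preimage hf, fun D x hx => ?_⟩
  exact Set.mem_preimage.2 (hfe D x hx ▸ Metric.mem_ball_self (by norm_num))

theorem exists_real_selection (hX : HasControlledSelections X τ) (hτ : ℵ₀ ≤ τ) {φ : X → Set ℝ}
    {η g : X → ℝ} (hφ : ∀ x, φ x ∈ compactsOrUniv ℝ) (hl : LowerHemicontinuous φ)
    (hconv : ∀ x, Convex ℝ (φ x)) (hη : LowerSemicontinuous η) (hη0 : ∀ x, 0 < η x)
    (hg : Continuous g) (hgφ : IsApproxSelection g η φ) :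
    ∃ f : X → ℝ, Continuous f ∧ IsSelection f φ ∧ ∀ x, dist (f x) (g x) < η x := by
  let e : ℝ ≃ₗᵢ[ℝ] ULift.{u} ℝ := (LinearIsometryEquiv.ulift ℝ ℝ).symm
  have := e.toHomeomorph.secondCountableTopology
  obtain ⟨f, hf, hfφ, hfg⟩ := hX (ULift.{u} ℝ) ((topologicalWeight_le_aleph0 _).trans hτ)
    (fun x => e '' φ x) η (e ∘ g)
    (fun x => image_mem_compactsOrUniv (hφ x) e.continuous e.surjective)
    (lowerHemicontinuous_image hl (e.continuous.comp continuous_snd))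
    (fun x => (hconv x).linear_image e.toLinearEquiv.toLinearMap) hη hη0 (e.continuous.comp hg)
    fun x => (Metric.infDist_image e.isometry).trans_lt (hgφ x)
  refine ⟨e.symm ∘ f, e.symm.continuous.comp hf, fun x => ?_, fun x => ?_⟩
  · obtain ⟨y, hy, hyf⟩ := hfφ x
    rwa [Function.comp_apply, ← hyf, e.symm_apply_apply]
  · rw [Function.comp_apply, ← e.dist_map, e.apply_symm_apply]
    exact hfg x

theorem exists_continuous_ge (hX : HasControlledSelections X τ) (hτ : ℵ₀ ≤ τ) {a : X → ℝ}
    (ha : UpperSemicontinuous a) : ∃ h : X → ℝ, Continuous h ∧ ∀ x, a x ≤ h x := by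
  have hlt : ∀ x, Real.arctan (a x) < Real.pi / 2 := fun x => Real.arctan_lt_pi_div_two _
  have hφ : LowerHemicontinuous fun x => Set.Icc (Real.arctan (a x)) (Real.pi / 2) :=
    lowerHemicontinuous_Icc
      (Real.continuous_arctan.comp_upperSemicontinuous ha Real.arctan_strictMono.monotone)
      lowerSemicontinuous_const hlt
  have happrox : IsApproxSelection (fun _ => 0) (fun _ => Real.pi / 2)
      fun x => Set.Icc (Real.arctan (a x)) (Real.pi / 2) := fun x => by
    have hmem : max (Real.arctan (a x)) 0 ∈ Set.Icc (Real.arctan (a x)) (Real.pi / 2) :=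
      ⟨le_max_left _ _, max_le (hlt x).le Real.pi_div_two_pos.le⟩
    refine (Metric.infDist_le_dist_of_mem hmem).trans_lt ?_
    rw [dist_zero_left, Real.norm_of_nonneg (le_max_right _ _)]
    exact max_lt (hlt x) Real.pi_div_two_pos
  obtain ⟨f, hf, hfφ, hfη⟩ := hX.exists_real_selection hτ
    (fun x => Or.inl ⟨Set.nonempty_Icc.2 (hlt x).le, isClosed_Icc, isCompact_Icc⟩) hφ
    (fun x => convex_Icc _ _) lowerSemicontinuous_const (fun _ => Real.pi_div_two_pos)
    continuous_const happrox
  have hfI : ∀ x, f x ∈ Set.Ioo (-(Real.pi / 2)) (Real.pi / 2) := fun x => by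
    simpa [abs_lt] using hfη x
  refine ⟨Real.tan ∘ f, Real.continuousOn_tan_Ioo.comp_continuous hf hfI, fun x => ?_⟩
  rw [← Real.arctan_le_arctan_iff, Function.comp_apply, Real.arctan_tan (hfI x).1 (hfI x).2]
  exact (hfφ x).1

theorem isCountablyParacompact (hX : HasControlledSelections X τ) (hτ : ℵ₀ ≤ τ) :
    IsCountablyParacompact X :=
  isCountablyParacompact_of_forall_exists_continuous_ge fun _ ha => hX.exists_continuous_ge hτ ha

end HasControlledSelections

theorem theorem4p3 (X : Type u) [TopologicalSpace X] [T1Space X] (τ : Cardinal.{u})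
    (hτ : ℵ₀ ≤ τ) :
    (IsCountablyParacompact X ∧ IsCollectionwiseNormal X τ) ↔
      ∀ (E : Type u) [NormedAddCommGroup E] [NormedSpace ℝ E] [CompleteSpace E],
        topologicalWeight E ≤ τ →
        ∀ (φ : X → Set E) (η : X → ℝ) (g : X → E),
          (∀ x, φ x ∈ compactsOrUniv E) → LowerHemicontinuous φ → (∀ x, Convex ℝ (φ x)) →
          LowerSemicontinuous η → (∀ x, 0 < η x) →
          Continuous g → IsApproxSelection g η φ →
          ∃ f : X → E, Continuous f ∧ IsSelection f φ ∧ ∀ x, dist (f x) (g x) < η x := by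
  constructor
  · rintro ⟨hc, hX⟩ E _ _ _ hE φ η g hφ hl hconv hη - hg hgφ
    exact exists_selection_dist_lt hX hc hτ hE hφ hl hconv hη hg hgφ
  · intro h
    have hX : HasControlledSelections X τ := h
    exact ⟨hX.isCountablyParacompact hτ, hX.isCollectionwiseNormal hτ⟩
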